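/- Let $(p_k)_{k\in\mathbb N}$, $\mathbb N=\{1,2,\dots\}$, satisfy $p_k>0$ and $\sum_{k}p_k=1$, and let $(I_k)_{k\in\mathbb N}$ be a partition of $[0,1)$ into pairwise disjoint half-open intervals $I_k=[a_k,a_k+p_k)$, in any arrangement. Let $T:[0,1)\to[0,1)$ be the full-branch affine map $T(x)=(x-a_k)/p_k$ for $x\in I_k$. For $n\ge1$ and $x\in[0,1)$ let the $n$-th digit $d_n(x)$ be the index $k$ with $T^{n-1}(x)\in I_k$, and let $D_n(x)=\#\{d_1(x),\dots,d_n(x)\}$ be the distinct-digit count. Let $\rho\ge1$ and suppose that $(p_k)$ is regularly varying with tail index $\rho$: there is $L:\mathbb N\to(0,\infty)$ that is slowly varying (i.e. $L(\lfloor\lambda k\rfloor)/L(k)\to1$ as $k\to\infty$ for every real $\lambda>0$) with $$\lim_{k\to\infty}\frac{p_k}{k^{-\rho}L(k)}=1 .$$ Then for every $0<\theta\le1$, $$\dim_{\mathrm H}\Big\{x\in[0,1):\lim_{n\to\infty}\frac{D_n(x)}{n}=\theta\Big\}=\frac1\rho ,$$ and moreover $$\dim_{\mathrm H}\Big\{x\in[0,1):\limsup_{n\to\infty}\frac{D_n(x)}{n}\ge\theta\Big\}\le\frac1\rho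 .$$ -/

import Mathlib

open Set Filter Topology

/-- A positive sequence `L` on the positive integers is slowly varying if
`L (⌊λ k⌋) / L k → 1` as `k → ∞`, for every real `λ > 0`.
(The value `L 0` is irrelevant.) -/
def SlowlyVarying (L : ℕ → ℝ) : Prop :=
  (∀ k : ℕ, 1 ≤ k → 0 < L k) ∧
    ∀ c : ℝ, 0 < c → Tendsto (fun k : ℕ => L ⌊c * (k : ℝ)⌋₊ / L k) atTop (𝓝 1)

/-- The sequence `p` is regularly varying with tail index `ρ`:
`p k ∼ k ^ (-ρ) * L k` for some slowly varying `L`. -/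
def RegularlyVarying (p : ℕ+ → ℝ) (ρ : ℝ) : Prop :=
  ∃ L : ℕ → ℝ, SlowlyVarying L ∧
    Tendsto (fun k : ℕ+ => p k / (((k : ℕ) : ℝ) ^ (-ρ) * L (k : ℕ))) atTop (𝓝 1)

/-- An affine full-branch countable iterated function system on `[0,1)`: a probability sequence
`p` with positive terms, and a partition of `[0,1)` into half-open intervals
`I k = [a k, a k + p k)` of length `p k`, in an arbitrary arrangement. -/
structure AffineSystem where
  /-- the branch weights -/
  p : ℕ+ → ℝ
  /-- the left endpoints of the branch intervals -/
  a : ℕ+ → ℝ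
  p_pos : ∀ k, 0 < p k
  p_sum : HasSum p 1
  disjoint : ∀ j k, j ≠ k → Disjoint (Ico (a j) (a j + p j)) (Ico (a k) (a k + p k))
  cover : (⋃ k, Ico (a k) (a k + p k)) = Ico (0 : ℝ) 1

namespace AffineSystem

variable (S : AffineSystem)

/-- The branch interval `I k`. -/
def I (k : ℕ+) : Set ℝ := Ico (S.a k) (S.a k + S.p k)

open Classical in
/-- The index `k` of the branch interval containing `x ∈ [0,1)` (and `1` if `x ∉ [0,1)`). -/
noncomputable def branch (x : ℝ) : ℕ+ :=
  if h : ∃ k, x ∈ S.I k then h.choose else 1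

theorem mem_I_branch {x : ℝ} (hx : x ∈ Ico (0 : ℝ) 1) : x ∈ S.I (S.branch x) := by
  have h : ∃ k, x ∈ S.I k := by
    rw [← S.cover] at hx
    exact mem_iUnion.1 hx
  unfold branch
  rw [dif_pos h]
  exact h.choose_spec

theorem branch_eq {x : ℝ} {k : ℕ+} (hx : x ∈ S.I k) : S.branch x = k := by
  have h01 : x ∈ Ico (0 : ℝ) 1 := by
    rw [← S.cover]
    exact mem_iUnion.2 ⟨k, hx⟩
  by_contra hne
  exact disjoint_left.1 (S.disjoint _ _ hne) (S.mem_I_branch h01) hx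

/-- The full-branch map, `T x = (x - inf (I k)) / p k` for `x ∈ I k`. -/
noncomputable def T (x : ℝ) : ℝ := (x - S.a (S.branch x)) / S.p (S.branch x)

theorem T_mem {x : ℝ} (hx : x ∈ Ico (0 : ℝ) 1) : S.T x ∈ Ico (0 : ℝ) 1 := by
  obtain ⟨h1, h2⟩ := S.mem_I_branch hx
  have hp := S.p_pos (S.branch x)
  refine ⟨div_nonneg (by linarith) hp.le, ?_⟩
  unfold T
  rw [div_lt_one hp]
  linarith

/-- The `n`-th digit `d_n(x)` for `n ≥ 1`: the index `k` with `T^(n-1) x ∈ I k`. -/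
noncomputable def digit (n : ℕ) (x : ℝ) : ℕ+ := S.branch (S.T^[n - 1] x)

/-- The distinct-digit count `D_n(x) = #{d_1(x), …, d_n(x)}`. -/
noncomputable def distinctCount (n : ℕ) (x : ℝ) : ℕ :=
  ((Finset.Icc 1 n).image (fun i => S.digit i x)).card

/-- `E_θ`: the points of `[0,1)` with `D_n(x) / n → θ`. -/
def levelSet (θ : ℝ) : Set ℝ :=
  {x | x ∈ Ico (0 : ℝ) 1 ∧
    Tendsto (fun n : ℕ => (S.distinctCount n x : ℝ) / (n : ℝ)) atTop (𝓝 θ)}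

/-- The points of `[0,1)` with `limsup D_n(x) / n ≥ θ`. (The ratio lies in `[0,1]`, so the real
limsup is the genuine one.) -/
def limsupSet (θ : ℝ) : Set ℝ :=
  {x | x ∈ Ico (0 : ℝ) 1 ∧
    θ ≤ limsup (fun n : ℕ => (S.distinctCount n x : ℝ) / (n : ℝ)) atTop}

end AffineSystem

/-!
The slow variation of `L`, used only for the ratio `1 / 2`, gives the power bounds
`c k ^ (-(ρ + δ)) ≤ p k ≤ C k ^ (-(ρ - δ))` for every `δ > 0`
(`RegularlyVarying.exists_rpow_le`, `RegularlyVarying.exists_le_rpow`), and these are all that the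
dimension computation needs to know about `p`.

*Upper bound.* For `s > 1 / ρ` the series `∑ p k ^ s` converges. A finite set `F` of letters
contributes at most `#F` distinct digits, so a point of the limsup set has, for infinitely many `n`,
a positive proportion of its first `n` digits outside `F`. Giving the letters outside `F` a huge
weight, and then choosing `F` so large that the weighted sum of `p k ^ s` hardly changes, shows that
the cylinders of length `n` with this property have total `s`-weight at most `2 ^ (-n)`
(`exists_weight`). Covering by those of length at least `N` shows that the limsup set, which
contains the level set, is null for the `s`-dimensional Hausdorff measure
(`AffineSystem.hausdorffMeasure_limsupSet`).

*Lower bound.* At the places `i` where `⌊θ i⌋` jumps, a digit is drawn uniformly from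
`[2 ^ (i + 1), 2 ^ (i + 2))`; elsewhere the digit is `1`. The blocks are disjoint, so the distinct
digit count is `⌊θ n⌋` or `⌊θ n⌋ + 1` (`card_blockDigits_bounds`) and all resulting points lie in
the level set. A cylinder of level `n` has mass `exp (-H n)`, where `H n` is of order `n ^ 2`, and
length at least `exp (-(ρ + δ) H n - O(n))`. As `H (n + 1) - H n = O(n)` is negligible against `H n`, each
scale lies between two levels with essentially the same exponent, and the mass distribution
principle gives dimension at least `s` for every `s < 1 / ρ`
(`AffineSystem.hausdorffMeasure_levelSet_ne_zero`). No separation of cylinders is needed: a set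
shorter than every cylinder of level `n` can only meet those containing one of two given points
(`AffineSystem.map_blockMeasure_le`).
-/

/-! ### Power bounds for regularly varying sequences -/

/-- The upper Potter bound. Only the ratio `c = 1 / 2` is needed: every `k` is reached from
`⌊k / 2⌋`, so an almost constant ratio `L ⌊k / 2⌋ / L k` propagates by strong induction. -/
theorem SlowlyVarying.exists_le_rpow {L : ℕ → ℝ} (hL : SlowlyVarying L) {δ : ℝ} (hδ : 0 < δ) :
    ∃ C : ℝ, 0 < C ∧ ∀ k : ℕ, 1 ≤ k → L k ≤ C * (k : ℝ) ^ δ := by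
  obtain ⟨hpos, hlim⟩ := hL
  have h2 : (1 / 2 : ℝ) ^ δ < 1 := Real.rpow_lt_one (by norm_num) (by norm_num) hδ
  obtain ⟨K, hK⟩ := eventually_atTop.1 ((hlim (1 / 2) (by norm_num)).eventually_const_lt h2)
  set C : ℝ := ∑ j ∈ Finset.range (K + 2), |L j / (j : ℝ) ^ δ| + 1 with hC
  have hC0 : 0 < C := by positivity
  refine ⟨C, hC0, fun k => ?_⟩
  induction k using Nat.strong_induction_on with
  | _ k ih =>
    intro hk1
    have hk0 : (0 : ℝ) < k := by exact_mod_cast hk1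
    have hkδ : (0 : ℝ) < (k : ℝ) ^ δ := Real.rpow_pos_of_pos hk0 _
    by_cases hkK : k < K + 2
    · rw [← div_le_iff₀ hkδ]
      have := Finset.single_le_sum (f := fun j : ℕ => |L j / (j : ℝ) ^ δ|)
        (fun i _ => abs_nonneg _) (Finset.mem_range.2 hkK)
      have h3 := le_abs_self (L k / (k : ℝ) ^ δ)
      linarith
    · push Not at hkK
      have hr := hK k (by omega)
      set j := ⌊(1 / 2 : ℝ) * k⌋₊ with hj
      have hjle : (j : ℝ) ≤ 1 / 2 * k := Nat.floor_le (by positivity)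
      have hj1 : 1 ≤ j := by
        rw [hj, Nat.one_le_floor_iff]
        have : (2 : ℝ) ≤ k := by exact_mod_cast (by omega : 2 ≤ k)
        linarith
      have hjk : j < k := by
        have : (j : ℝ) < k := by linarith
        exact_mod_cast this
      rw [lt_div_iff₀ (hpos k hk1)] at hr
      have h4 := ih j hjk hj1
      have h5 : (j : ℝ) ^ δ ≤ (1 / 2 : ℝ) ^ δ * (k : ℝ) ^ δ := by
        rw [← Real.mul_rpow (by norm_num) hk0.le]
        exact Real.rpow_le_rpow (by positivity) hjle hδ.le
      have h6 : (0 : ℝ) < (1 / 2 : ℝ) ^ δ := by positivity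
      have h7 : (1 / 2 : ℝ) ^ δ * L k ≤ (1 / 2 : ℝ) ^ δ * (C * (k : ℝ) ^ δ) := by
        nlinarith
      exact le_of_mul_le_mul_left h7 h6

theorem SlowlyVarying.inv {L : ℕ → ℝ} (hL : SlowlyVarying L) :
    SlowlyVarying fun k => (L k)⁻¹ := by
  refine ⟨fun k hk => inv_pos.2 (hL.1 k hk), fun c hc => ?_⟩
  have := (hL.2 c hc).inv₀ one_ne_zero
  simpa [div_eq_mul_inv, mul_comm] using this

/-- The lower Potter bound, which is the upper one for `1 / L`. -/
theorem SlowlyVarying.exists_rpow_le {L : ℕ → ℝ} (hL : SlowlyVarying L) {δ : ℝ} (hδ : 0 < δ) :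
    ∃ c : ℝ, 0 < c ∧ ∀ k : ℕ, 1 ≤ k → c * (k : ℝ) ^ (-δ) ≤ L k := by
  obtain ⟨C, hC, h⟩ := hL.inv.exists_le_rpow hδ
  refine ⟨C⁻¹, inv_pos.2 hC, fun k hk => ?_⟩
  have hk0 : (0 : ℝ) < k := by exact_mod_cast hk
  rw [Real.rpow_neg hk0.le, ← mul_inv]
  exact inv_le_of_inv_le₀ (hL.1 k hk) (h k hk)

theorem exists_pos_le_of_tendsto_one {f : ℕ+ → ℝ} (hf : ∀ k, 0 < f k)
    (h : Tendsto f atTop (𝓝 1)) : ∃ c : ℝ, 0 < c ∧ ∀ k, c ≤ f k := by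
  obtain ⟨K, hK⟩ := eventually_atTop.1
    (h.eventually_const_lt (show (1 / 2 : ℝ) < 1 by norm_num))
  obtain ⟨m, -, hm⟩ := Finset.exists_min_image (Finset.Icc 1 K) f
    ⟨1, Finset.mem_Icc.2 ⟨le_rfl, one_le⟩⟩
  refine ⟨min (1 / 2) (f m), lt_min (by norm_num) (hf m), fun k => ?_⟩
  rcases le_total k K with hk | hk
  · exact (min_le_right _ _).trans (hm k (Finset.mem_Icc.2 ⟨one_le, hk⟩))
  · exact (min_le_left _ _).trans (hK k hk).le

theorem RegularlyVarying.exists_rpow_le {p : ℕ+ → ℝ} {ρ : ℝ} (hp : RegularlyVarying p ρ)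
    (h0 : ∀ k, 0 < p k) {δ : ℝ} (hδ : 0 < δ) :
    ∃ c : ℝ, 0 < c ∧ ∀ k : ℕ+, c * ((k : ℕ) : ℝ) ^ (-(ρ + δ)) ≤ p k := by
  obtain ⟨L, hL, hlim⟩ := hp
  obtain ⟨c₁, hc₁, h₁⟩ := hL.exists_rpow_le hδ
  have hk0 (k : ℕ+) : (0 : ℝ) < ((k : ℕ) : ℝ) := by exact_mod_cast k.pos
  have hden (k : ℕ+) : 0 < ((k : ℕ) : ℝ) ^ (-ρ) * L (k : ℕ) :=
    mul_pos (Real.rpow_pos_of_pos (hk0 k) _) (hL.1 _ k.pos)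
  obtain ⟨c₂, hc₂, h₂⟩ := exists_pos_le_of_tendsto_one (fun k => div_pos (h0 k) (hden k)) hlim
  refine ⟨c₂ * c₁, mul_pos hc₂ hc₁, fun k => ?_⟩
  have h3 := (le_div_iff₀ (hden k)).1 (h₂ k)
  refine le_trans ?_ h3
  rw [neg_add, Real.rpow_add (hk0 k)]
  have h4 := mul_le_mul_of_nonneg_left (h₁ k k.pos)
    (mul_pos hc₂ (Real.rpow_pos_of_pos (hk0 k) (-ρ))).le
  linarith

theorem RegularlyVarying.exists_le_rpow {p : ℕ+ → ℝ} {ρ : ℝ} (hp : RegularlyVarying p ρ)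
    (h0 : ∀ k, 0 < p k) {δ : ℝ} (hδ : 0 < δ) :
    ∃ C : ℝ, 0 < C ∧ ∀ k : ℕ+, p k ≤ C * ((k : ℕ) : ℝ) ^ (-(ρ - δ)) := by
  obtain ⟨L, hL, hlim⟩ := hp
  obtain ⟨c₁, hc₁, h₁⟩ := hL.exists_le_rpow hδ
  have hk0 (k : ℕ+) : (0 : ℝ) < ((k : ℕ) : ℝ) := by exact_mod_cast k.pos
  have hden (k : ℕ+) : 0 < ((k : ℕ) : ℝ) ^ (-ρ) * L (k : ℕ) :=
    mul_pos (Real.rpow_pos_of_pos (hk0 k) _) (hL.1 _ k.pos)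
  have hinv := hlim.inv₀ one_ne_zero
  rw [inv_one] at hinv
  obtain ⟨c₂, hc₂, h₂⟩ := exists_pos_le_of_tendsto_one
    (fun k => inv_pos.2 (div_pos (h0 k) (hden k))) hinv
  refine ⟨c₂⁻¹ * c₁, mul_pos (inv_pos.2 hc₂) hc₁, fun k => ?_⟩
  have h3 := le_inv_of_le_inv₀ hc₂ (h₂ k)
  rw [div_le_iff₀ (hden k)] at h3
  refine h3.trans ?_
  rw [neg_sub, sub_eq_neg_add, Real.rpow_add (hk0 k)]
  have h4 := mul_le_mul_of_nonneg_left (h₁ k k.pos)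
    (mul_pos (inv_pos.2 hc₂) (Real.rpow_pos_of_pos (hk0 k) (-ρ))).le
  linarith

/-- The critical exponent of the series `∑ p k ^ s` is `1 / ρ`. -/
theorem RegularlyVarying.summable_rpow {p : ℕ+ → ℝ} {ρ : ℝ} (hp : RegularlyVarying p ρ)
    (hρ : 0 < ρ) (h0 : ∀ k, 0 < p k) {s : ℝ} (hs : 1 / ρ < s) :
    Summable fun k => p k ^ s := by
  have hs0 : 0 < s := (by positivity : 0 < 1 / ρ).trans hs
  have h1 : 1 < ρ * s := by rwa [div_lt_iff₀' hρ] at hs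
  -- This `δ` puts `ρ - δ` halfway between `1 / s` and `ρ`, so that `(ρ - δ) s > 1`.
  obtain ⟨C, hC, h⟩ := hp.exists_le_rpow h0 (δ := (ρ - 1 / s) / 2) (by
    have : 1 / s < ρ := by rwa [div_lt_iff₀ hs0]
    linarith)
  have hexp : -(ρ - (ρ - 1 / s) / 2) * s < -1 := by
    field_simp
    linarith
  have hsum : Summable fun k : ℕ+ =>
      C ^ s * ((k : ℕ) : ℝ) ^ (-(ρ - (ρ - 1 / s) / 2) * s) :=
    ((Real.summable_nat_rpow.2 hexp).comp_injective PNat.coe_injective).mul_left _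
  refine Summable.of_nonneg_of_le (fun k => Real.rpow_nonneg (h0 k).le _) (fun k => ?_) hsum
  rw [Real.rpow_mul (by positivity), ← Real.mul_rpow hC.le (by positivity)]
  exact Real.rpow_le_rpow (h0 k).le (h k) hs0.le

/-! ### Cylinders -/

namespace AffineSystem

variable (S : AffineSystem)

/-- The length of the cylinder of the first `n` letters of `d`. -/
noncomputable def cylLength (d : ℕ → ℕ+) (n : ℕ) : ℝ := ∏ i ∈ Finset.range n, S.p (d i)

/-- The left endpoint of the cylinder of the first `n` letters of `d`. -/
noncomputable def cylLeft (d : ℕ → ℕ+) (n : ℕ) : ℝ :=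
  ∑ i ∈ Finset.range n, S.a (d i) * S.cylLength d i

theorem cylLength_succ (d : ℕ → ℕ+) (n : ℕ) :
    S.cylLength d (n + 1) = S.cylLength d n * S.p (d n) :=
  Finset.prod_range_succ _ _

theorem cylLeft_succ (d : ℕ → ℕ+) (n : ℕ) :
    S.cylLeft d (n + 1) = S.cylLeft d n + S.a (d n) * S.cylLength d n :=
  Finset.sum_range_succ _ _

theorem cylLength_pos (d : ℕ → ℕ+) (n : ℕ) : 0 < S.cylLength d n :=
  Finset.prod_pos fun _ _ => S.p_pos _

theorem I_subset (k : ℕ+) : S.I k ⊆ Ico (0 : ℝ) 1 := by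
  rw [← S.cover]
  exact subset_iUnion (fun k => Ico (S.a k) (S.a k + S.p k)) k

theorem a_nonneg (k : ℕ+) : 0 ≤ S.a k :=
  (S.I_subset k (left_mem_Ico.2 (lt_add_of_pos_right _ (S.p_pos k)))).1

theorem a_add_p_le_one (k : ℕ+) : S.a k + S.p k ≤ 1 := by
  by_contra! h
  have := (Ico_subset_Ico_iff (lt_add_of_pos_right _ (S.p_pos k))).1 (S.I_subset k)
  linarith [this.2]

theorem iterate_T_mem {x : ℝ} (hx : x ∈ Ico (0 : ℝ) 1) (n : ℕ) : S.T^[n] x ∈ Ico (0 : ℝ) 1 := by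
  induction n with
  | zero => exact hx
  | succ n ih => rw [Function.iterate_succ_apply']; exact S.T_mem ih

theorem digit_succ (n : ℕ) (x : ℝ) : S.digit (n + 1) x = S.branch (S.T^[n] x) := rfl

/-- A point is recovered from its first `n` digits and its `n`-th iterate. -/
theorem eq_cylLeft_add {x : ℝ} {d : ℕ → ℕ+} {n : ℕ} (hd : ∀ i < n, S.digit (i + 1) x = d i) :
    x = S.cylLeft d n + S.cylLength d n * S.T^[n] x := by
  induction n with
  | zero => simp [cylLeft, cylLength]
  | succ n ih =>
    conv_lhs => rw [ih fun i hi => hd i (by omega)]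
    have hn := hd n (by omega)
    rw [digit_succ] at hn
    rw [cylLeft_succ, cylLength_succ, Function.iterate_succ_apply', T, hn]
    have := (S.p_pos (d n)).ne'
    field_simp
    ring

theorem ediam_digits_le (d : ℕ → ℕ+) (n : ℕ) :
    Metric.ediam {x | x ∈ Ico (0 : ℝ) 1 ∧ ∀ i < n, S.digit (i + 1) x = d i} ≤
      ENNReal.ofReal (S.cylLength d n) := by
  refine Metric.ediam_le fun x hx y hy => ?_
  rw [edist_dist, Real.dist_eq]
  refine ENNReal.ofReal_le_ofReal ?_
  have h1 := S.eq_cylLeft_add hx.2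
  have h2 := S.eq_cylLeft_add hy.2
  obtain ⟨h3, h4⟩ := S.iterate_T_mem hx.1 n
  obtain ⟨h5, h6⟩ := S.iterate_T_mem hy.1 n
  have h7 : x - y = S.cylLength d n * (S.T^[n] x - S.T^[n] y) := by
    linear_combination h1 - h2
  rw [h7, abs_mul, abs_of_pos (S.cylLength_pos d n)]
  exact mul_le_of_le_one_right (S.cylLength_pos d n).le (abs_le.2 ⟨by linarith, by linarith⟩)

/-- The points of a cylinder have the prescribed digits. -/
theorem digit_eq_of_mem_cylinder {x : ℝ} {d : ℕ → ℕ+} {n : ℕ}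
    (hx : x ∈ Ico (S.cylLeft d n) (S.cylLeft d n + S.cylLength d n)) :
    ∀ i < n, S.digit (i + 1) x = d i := by
  induction n with
  | zero => intro i hi; omega
  | succ n ih =>
    have hP := S.cylLength_pos d n
    rw [cylLeft_succ, cylLength_succ] at hx
    have ha := mul_nonneg (S.a_nonneg (d n)) hP.le
    have hap := mul_le_mul_of_nonneg_left (S.a_add_p_le_one (d n)) hP.le
    have hih := ih ⟨by linarith [hx.1], by nlinarith [hx.2]⟩
    intro i hi
    rcases Nat.lt_succ_iff_lt_or_eq.1 hi with h | rfl
    · exact hih i h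
    · rw [digit_succ]
      refine S.branch_eq ?_
      have hx' := S.eq_cylLeft_add hih
      constructor
      · refine le_of_mul_le_mul_left ?_ hP
        linarith [hx.1]
      · refine lt_of_mul_lt_mul_left ?_ hP.le
        nlinarith [hx.2]

theorem p_lt_one (k : ℕ+) : S.p k < 1 := by
  have h := S.p_sum.summable.sum_le_tsum {k, k + 1} (fun i _ => (S.p_pos i).le)
  rw [S.p_sum.tsum_eq, Finset.sum_pair (by simp [← PNat.coe_inj])] at h
  linarith [S.p_pos (k + 1)]

theorem exists_p_le : ∃ r : ℝ, 0 ≤ r ∧ r < 1 ∧ ∀ k, S.p k ≤ r := by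
  refine ⟨max (1 - S.p 1) (S.p 1), ?_, max_lt (by linarith [S.p_pos 1]) (S.p_lt_one 1),
    fun k => ?_⟩
  · exact (S.p_pos 1).le.trans (le_max_right _ _)
  · by_cases hk : k = 1
    · exact hk ▸ le_max_right _ _
    · refine le_trans ?_ (le_max_left _ _)
      have h := S.p_sum.summable.sum_le_tsum {k, 1} (fun i _ => (S.p_pos i).le)
      rw [S.p_sum.tsum_eq, Finset.sum_pair hk] at h
      linarith

theorem distinctCount_eq (n : ℕ) (x : ℝ) :
    S.distinctCount n x =
      ((Finset.range n).image fun i => S.digit (i + 1) x).card := by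
  unfold distinctCount
  congr 1
  ext k
  simp only [Finset.mem_image, Finset.mem_Icc, Finset.mem_range]
  constructor
  · rintro ⟨i, hi, rfl⟩
    exact ⟨i - 1, by omega, by rw [Nat.sub_add_cancel hi.1]⟩
  · rintro ⟨i, hi, rfl⟩
    exact ⟨i + 1, by omega, rfl⟩

end AffineSystem

/-! ### The upper bound -/

theorem ENNReal.tsum_prod_pow {α : Type*} (f : α → ENNReal) (n : ℕ) :
    ∑' w : Fin n → α, ∏ i, f (w i) = (∑' k, f k) ^ n := by
  induction n with
  | zero => simp [tsum_fintype]
  | succ n ih =>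
    rw [← (Fin.consEquiv fun _ : Fin (n + 1) => α).tsum_eq, ENNReal.tsum_prod', pow_succ', ← ih,
      ← ENNReal.tsum_mul_right]
    refine tsum_congr fun k => ?_
    rw [← ENNReal.tsum_mul_left]
    refine tsum_congr fun w => ?_
    simp [Fin.consEquiv, Fin.prod_univ_succ]

/-- An exponential weight on the letters outside a large finite set `F`: it makes the weighted sum
at most `1 / 2`, yet does not decrease the product of `f` over any word in which at least a
proportion `1 / M` of the letters lies outside `F`. -/
theorem exists_weight {α : Type*} [DecidableEq α] {f : α → ENNReal} (hf : ∑' k, f k ≠ ⊤) (M : ℕ) :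
    ∃ (F : Finset α) (h : α → ENNReal), ∑' k, h k ≤ 1 / 2 ∧
      ∀ (n : ℕ) (w : Fin n → α), n ≤ M * (Finset.univ.filter fun i => w i ∉ F).card →
        ∏ i, f (w i) ≤ ∏ i, h (w i) := by
  set A := ∑' k, f k with hA
  -- Letters outside `F` get the weight `R ^ M`, and every letter is then divided by `R`.
  set R : ENNReal := 2 * (A + 1) with hR
  have hR0 : R ≠ 0 := by simp [hR]
  have hRtop : R ≠ ⊤ := ENNReal.mul_ne_top (by simp) (by simp [hf])
  have hR1 : 1 ≤ R := by
    rw [hR, mul_add]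
    exact le_add_left (by norm_num)
  have hRM0 : R ^ M ≠ 0 := pow_ne_zero _ hR0
  have hRMtop : R ^ M ≠ ⊤ := ENNReal.pow_ne_top hRtop
  obtain ⟨F, hF⟩ := ((ENNReal.tendsto_tsum_compl_atTop_zero hf).eventually_le_const
    (show 0 < (R ^ M)⁻¹ from ENNReal.inv_pos.2 hRMtop)).exists
  refine ⟨F, fun k => f k * (if k ∈ F then 1 else R ^ M) / R, ?_, fun n w hn => ?_⟩
  · simp_rw [div_eq_mul_inv]
    rw [ENNReal.tsum_mul_right]
    have h1 : ∑' k, f k * (if k ∈ F then 1 else R ^ M) ≤ A + 1 := by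
      calc ∑' k, f k * (if k ∈ F then 1 else R ^ M)
          ≤ ∑' k, (f k + R ^ M * ((F : Set α)ᶜ.indicator f k)) := by
            refine ENNReal.tsum_le_tsum fun k => ?_
            by_cases hk : k ∈ F <;> simp [hk, mul_comm]
        _ = A + R ^ M * ∑' k : {x // x ∉ F}, f k := by
            rw [ENNReal.tsum_add, ENNReal.tsum_mul_left]
            congr 2
            exact (tsum_subtype (F : Set α)ᶜ f).symm
        _ ≤ A + 1 := by
            gcongr
            calc _ ≤ R ^ M * (R ^ M)⁻¹ := by gcongr
              _ = 1 := ENNReal.mul_inv_cancel hRM0 hRMtop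
    calc _ ≤ (A + 1) * R⁻¹ := by gcongr
      _ = 1 * 2⁻¹ := by
        rw [hR, ENNReal.mul_inv (by simp) (by simp), mul_comm (2⁻¹ : ENNReal), ← mul_assoc,
          ENNReal.mul_inv_cancel (by simp) (by simp [hf])]
  · have h1 : ∏ i, (f (w i) * (if w i ∈ F then 1 else R ^ M) / R) =
        (∏ i, f (w i)) * (R ^ (M * (Finset.univ.filter fun i => w i ∉ F).card) * (R ^ n)⁻¹) := by
      simp_rw [div_eq_mul_inv]
      rw [Finset.prod_mul_distrib, Finset.prod_mul_distrib, Finset.prod_ite]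
      simp [ENNReal.inv_pow, pow_mul, mul_assoc]
    rw [h1]
    refine le_mul_of_one_le_right' ?_
    calc (1 : ENNReal) = R ^ n * (R ^ n)⁻¹ :=
          (ENNReal.mul_inv_cancel (pow_ne_zero _ hR0) (ENNReal.pow_ne_top hRtop)).symm
      _ ≤ _ := by
          gcongr

namespace AffineSystem

variable (S : AffineSystem)

/-- At most `#F` distinct digits lie in `F`. -/
theorem distinctCount_le (F : Finset ℕ+) (n : ℕ) (x : ℝ) :
    S.distinctCount n x ≤
      F.card + (Finset.univ.filter fun i : Fin n => S.digit (i + 1) x ∉ F).card := by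
  rw [distinctCount_eq]
  refine (Finset.card_le_card (t := F ∪
    (Finset.univ.filter fun i : Fin n => S.digit (i + 1) x ∉ F).image
      fun i : Fin n => S.digit (i + 1) x) fun k hk => ?_).trans
    ((Finset.card_union_le _ _).trans (Nat.add_le_add_left Finset.card_image_le _))
  obtain ⟨i, hi, rfl⟩ := Finset.mem_image.1 hk
  by_cases h : S.digit (i + 1) x ∈ F
  · exact Finset.mem_union_left _ h
  · exact Finset.mem_union_right _ (Finset.mem_image.2
      ⟨⟨i, Finset.mem_range.1 hi⟩, by simpa using h, rfl⟩)

theorem frequently_le_card {θ : ℝ} (hθ : 0 < θ) {M : ℕ} (hM : 4 / θ ≤ M) (F : Finset ℕ+) {x : ℝ}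
    (hx : x ∈ S.limsupSet θ) :
    ∃ᶠ n in atTop,
      n ≤ M * (Finset.univ.filter fun i : Fin n => S.digit (i + 1) x ∉ F).card := by
  have hbdd : IsBoundedUnder (· ≥ ·) atTop
      (fun n : ℕ => (S.distinctCount n x : ℝ) / (n : ℝ)) :=
    isBoundedUnder_of ⟨0, fun n => by positivity⟩
  have h := frequently_lt_of_lt_limsup hbdd.isCoboundedUnder_le
    ((half_lt_self hθ).trans_le hx.2)
  refine (h.and_eventually (eventually_ge_atTop (⌈4 * F.card / θ⌉₊ + 1))).mono ?_
  rintro n ⟨h1, h2⟩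
  have hn0 : (0 : ℝ) < n := by exact_mod_cast (by omega : 0 < n)
  have h3 : 4 * F.card / θ ≤ n :=
    (Nat.le_ceil _).trans (by exact_mod_cast (Nat.le_succ _).trans h2)
  rw [div_le_iff₀ hθ] at h3 hM
  rw [lt_div_iff₀ hn0] at h1
  have h4 : (S.distinctCount n x : ℝ) ≤ F.card +
      (Finset.univ.filter fun i : Fin n => S.digit (i + 1) x ∉ F).card := by
    exact_mod_cast S.distinctCount_le F n x
  set c : ℝ := ((Finset.univ.filter fun i : Fin n => S.digit (i + 1) x ∉ F).card : ℝ) with hc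
  have h5 : θ * n ≤ 4 * c := by linarith
  have h6 : (n : ℝ) ≤ M * c := by
    have hc0 : 0 ≤ c := Nat.cast_nonneg _
    have : θ * n ≤ θ * (M * c) := by nlinarith
    exact le_of_mul_le_mul_left this hθ
  rw [hc] at h6
  exact_mod_cast h6

/-- If `∑ p k ^ s` converges then `limsupSet θ` is a null set for the `s`-dimensional Hausdorff
measure: it is covered by the cylinders of words with many letters outside a finite set. -/
theorem hausdorffMeasure_limsupSet {s : ℝ} (hs : 0 < s) (hsum : Summable fun k => S.p k ^ s)
    {θ : ℝ} (hθ : 0 < θ) : MeasureTheory.Measure.hausdorffMeasure s (S.limsupSet θ) = 0 := by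
  set f : ℕ+ → ENNReal := fun k => ENNReal.ofReal (S.p k) ^ s with hf
  have hf_top : ∑' k, f k ≠ ⊤ := by
    have : f = fun k => ENNReal.ofReal (S.p k ^ s) :=
      funext fun k => ENNReal.ofReal_rpow_of_pos (S.p_pos k)
    rw [this]
    exact hsum.tsum_ofReal_ne_top
  obtain ⟨F, h, hh, hprod⟩ := exists_weight hf_top ⌈4 / θ⌉₊
  set M := ⌈4 / θ⌉₊ with hM
  obtain ⟨r, hr0, hr1, hr⟩ := S.exists_p_le
  -- Words are extended by the letter `1`; only their first letters matter.
  let ext : ∀ n : ℕ, (Fin n → ℕ+) → ℕ → ℕ+ := fun n w i => if hi : i < n then w ⟨i, hi⟩ else 1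
  let t : ∀ N : ℕ, (Σ n : ℕ, Fin (N + n) → ℕ+) → Set ℝ := fun N w =>
    {x | x ∈ Ico (0 : ℝ) 1 ∧ (∀ i < N + w.1, S.digit (i + 1) x = ext (N + w.1) w.2 i) ∧
      N + w.1 ≤ M * (Finset.univ.filter fun i => w.2 i ∉ F).card}
  have hlen (N : ℕ) (w : Σ n : ℕ, Fin (N + n) → ℕ+) :
      S.cylLength (ext (N + w.1) w.2) (N + w.1) = ∏ i, S.p (w.2 i) := by
    rw [cylLength, Finset.prod_range]
    exact Finset.prod_congr rfl fun i _ => by simp [ext]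
  have hdiam (N : ℕ) (w : Σ n : ℕ, Fin (N + n) → ℕ+) :
      Metric.ediam (t N w) ≤ ENNReal.ofReal (∏ i, S.p (w.2 i)) := by
    rw [← hlen]
    have hsub : t N w ⊆ {x | x ∈ Ico (0 : ℝ) 1 ∧
        ∀ i < N + w.1, S.digit (i + 1) x = ext (N + w.1) w.2 i} := fun x hx => ⟨hx.1, hx.2.1⟩
    exact (Metric.ediam_mono hsub).trans (S.ediam_digits_le _ _)
  have hdiam_rpow (N : ℕ) (w : Σ n : ℕ, Fin (N + n) → ℕ+) :
      Metric.ediam (t N w) ^ s ≤ ∏ i, h (w.2 i) := by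
    by_cases hw : N + w.1 ≤ M * (Finset.univ.filter fun i => w.2 i ∉ F).card
    · refine le_trans ?_ (hprod _ w.2 hw)
      rw [hf, ENNReal.prod_rpow_of_nonneg hs.le,
        ← ENNReal.ofReal_prod_of_nonneg fun i _ => (S.p_pos _).le]
      exact ENNReal.rpow_le_rpow (hdiam N w) hs.le
    · have : t N w = ∅ := eq_empty_of_forall_notMem fun x hx => hw hx.2.2
      simp [this, ENNReal.zero_rpow_of_pos hs]
  have hsum_le (N : ℕ) : ∑' w, Metric.ediam (t N w) ^ s ≤ (2⁻¹ : ENNReal) ^ N * 2 := by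
    calc ∑' w, Metric.ediam (t N w) ^ s
        ≤ ∑' w : Σ n : ℕ, Fin (N + n) → ℕ+, ∏ i, h (w.2 i) :=
          ENNReal.tsum_le_tsum (hdiam_rpow N)
      _ = ∑' n : ℕ, (∑' k, h k) ^ (N + n) := by
          rw [ENNReal.tsum_sigma']
          exact tsum_congr fun n => ENNReal.tsum_prod_pow h (N + n)
      _ ≤ ∑' n : ℕ, (2⁻¹ : ENNReal) ^ (N + n) :=
          ENNReal.tsum_le_tsum fun n => by
            gcongr
            simpa using hh
      _ = (2⁻¹ : ENNReal) ^ N * 2 := by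
          simp_rw [pow_add]
          rw [ENNReal.tsum_mul_left, ENNReal.tsum_geometric, ENNReal.one_sub_inv_two, inv_inv]
  have hlim : Tendsto (fun N : ℕ => (2⁻¹ : ENNReal) ^ N * 2) atTop (𝓝 0) := by
    simpa using ENNReal.Tendsto.mul_const (b := 2)
      (ENNReal.tendsto_pow_atTop_nhds_zero_of_lt_one ENNReal.one_half_lt_one) (Or.inr (by simp))
  have hrlim : Tendsto (fun N : ℕ => ENNReal.ofReal (r ^ N)) atTop (𝓝 0) := by
    simpa using ENNReal.tendsto_ofReal (tendsto_pow_atTop_nhds_zero_of_lt_one hr0 hr1)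
  refine le_antisymm ?_ zero_le
  refine (MeasureTheory.Measure.hausdorffMeasure_le_liminf_tsum s _ _ hrlim t
    (Eventually.of_forall fun N w => (hdiam N w).trans (ENNReal.ofReal_le_ofReal ?_))
    (Eventually.of_forall fun N x hx => ?_)).trans ?_
  · calc ∏ i, S.p (w.2 i) ≤ ∏ _i : Fin (N + w.1), r :=
          Finset.prod_le_prod (fun i _ => (S.p_pos _).le) fun i _ => hr _
      _ = r ^ (N + w.1) := by simp
      _ ≤ r ^ N := pow_le_pow_of_le_one hr0 hr1.le (Nat.le_add_right _ _)
  · obtain ⟨n, hn, hNn⟩ := ((S.frequently_le_card hθ (Nat.le_ceil _) F hx).and_eventually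
      (eventually_ge_atTop N)).exists
    obtain ⟨m, rfl⟩ := Nat.exists_eq_add_of_le hNn
    exact mem_iUnion.2 ⟨⟨m, fun i => S.digit (i + 1) x⟩, hx.1,
      fun i hi => by simp [ext, hi], hn⟩
  · refine (liminf_le_liminf (Eventually.of_forall hsum_le)).trans ?_
    rw [hlim.liminf_eq]

theorem dimH_limsupSet_le {ρ : ℝ} (hρ : 0 < ρ) (hp : RegularlyVarying S.p ρ) {θ : ℝ}
    (hθ : 0 < θ) : dimH (S.limsupSet θ) ≤ ENNReal.ofReal (1 / ρ) := by
  refine ENNReal.le_of_forall_pos_le_add fun ε hε _ => ?_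
  have hs : 1 / ρ < 1 / ρ + ε := lt_add_of_pos_right _ (by exact_mod_cast hε)
  have hs0 : 0 < 1 / ρ + ε := (by positivity : 0 < 1 / ρ).trans hs
  have h0 := S.hausdorffMeasure_limsupSet hs0 (hp.summable_rpow hρ S.p_pos hs) hθ
  have h1 : dimH (S.limsupSet θ) ≤ ((1 / ρ + ε).toNNReal : ENNReal) :=
    dimH_le_of_hausdorffMeasure_ne_top (by rw [Real.coe_toNNReal _ hs0.le, h0]; simp)
  refine h1.trans (le_of_eq ?_)
  change ENNReal.ofReal (1 / ρ + ε) = _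
  rw [ENNReal.ofReal_add (by positivity) ε.coe_nonneg, ENNReal.ofReal_coe_nnreal]

theorem levelSet_subset_limsupSet (θ : ℝ) : S.levelSet θ ⊆ S.limsupSet θ :=
  fun _ hx => ⟨hx.1, hx.2.limsup_eq.ge⟩

end AffineSystem

/-! ### Points with prescribed digits -/

namespace AffineSystem

variable (S : AffineSystem)

/-- The point with digit sequence `d`, as the supremum of the left endpoints of its cylinders. If
all digits of `d` from some place on are the label of the rightmost interval, then the half-open
cylinders have empty intersection and this is a right endpoint instead. -/
noncomputable def pointOfDigits (d : ℕ → ℕ+) : ℝ := ⨆ n, S.cylLeft d n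

theorem cylLeft_monotone (d : ℕ → ℕ+) : Monotone (S.cylLeft d) :=
  monotone_nat_of_le_succ fun n => by
    rw [cylLeft_succ]
    linarith [mul_nonneg (S.a_nonneg (d n)) (S.cylLength_pos d n).le]

theorem cylRight_antitone (d : ℕ → ℕ+) :
    Antitone fun n => S.cylLeft d n + S.cylLength d n :=
  antitone_nat_of_succ_le fun n => by
    rw [cylLeft_succ, cylLength_succ]
    nlinarith [S.a_add_p_le_one (d n), S.cylLength_pos d n]

theorem cylLeft_le_cylRight (d : ℕ → ℕ+) (m n : ℕ) :
    S.cylLeft d m ≤ S.cylLeft d n + S.cylLength d n := by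
  have h1 := S.cylLeft_monotone d (le_max_left m n)
  have h2 := S.cylRight_antitone d (le_max_right m n)
  simp only at h2
  linarith [S.cylLength_pos d (max m n)]

theorem bddAbove_cylLeft (d : ℕ → ℕ+) : BddAbove (range (S.cylLeft d)) :=
  ⟨_, forall_mem_range.2 fun m => S.cylLeft_le_cylRight d m 0⟩

/-- At most one branch interval ends at `1`. -/
theorem eq_of_a_add_p_eq_one {j k : ℕ+} (hj : S.a j + S.p j = 1) (hk : S.a k + S.p k = 1) :
    j = k := by
  by_contra hne
  have hj' : max (S.a j) (S.a k) < 1 := max_lt (by linarith [S.p_pos j]) (by linarith [S.p_pos k])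
  have hmem_j : max (S.a j) (S.a k) ∈ Ico (S.a j) (S.a j + S.p j) :=
    ⟨le_max_left _ _, hj.symm ▸ hj'⟩
  have hmem_k : max (S.a j) (S.a k) ∈ Ico (S.a k) (S.a k + S.p k) :=
    ⟨le_max_right _ _, hk.symm ▸ hj'⟩
  exact Set.disjoint_left.1 (S.disjoint j k hne) hmem_j hmem_k

theorem pointOfDigits_mem_cylinder {d : ℕ → ℕ+}
    (hd : ∀ n, ∃ i, n ≤ i ∧ ∃ j, n ≤ j ∧ d i ≠ d j) (n : ℕ) :
    S.pointOfDigits d ∈ Ico (S.cylLeft d n) (S.cylLeft d n + S.cylLength d n) := by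
  refine ⟨le_ciSup (S.bddAbove_cylLeft d) n, ?_⟩
  have key : ∃ m, n ≤ m ∧ S.a (d m) + S.p (d m) < 1 := by
    obtain ⟨i, hi, j, hj, hij⟩ := hd n
    by_contra! h
    exact hij (S.eq_of_a_add_p_eq_one ((S.a_add_p_le_one _).antisymm (h i hi))
      ((S.a_add_p_le_one _).antisymm (h j hj)))
  obtain ⟨m, hm, hlt⟩ := key
  have h1 : S.pointOfDigits d ≤ S.cylLeft d (m + 1) + S.cylLength d (m + 1) :=
    ciSup_le fun i => S.cylLeft_le_cylRight d i (m + 1)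
  have h2 := S.cylRight_antitone d hm
  simp only at h2
  rw [cylLeft_succ, cylLength_succ] at h1
  nlinarith [S.cylLength_pos d m]

end AffineSystem

/-! ### Digit sequences with a prescribed rate of new digits -/

/-- The number of digits allowed at place `i` (counted from `0`): the block `[2 ^ (i + 1),
2 ^ (i + 2))` at the places where `⌊θ i⌋` jumps, and only the digit `1` elsewhere. In both cases
the allowed digits are `blockSize θ i + j` with `j < blockSize θ i`. -/
noncomputable def blockSize (θ : ℝ) (i : ℕ) : ℕ :=
  if ⌊θ * i⌋₊ < ⌊θ * (i + 1 : ℕ)⌋₊ then 2 ^ (i + 1) else 1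

theorem blockSize_pos (θ : ℝ) (i : ℕ) : 0 < blockSize θ i := by
  unfold blockSize
  split_ifs <;> positivity

instance blockSize_neZero (θ : ℝ) (i : ℕ) : NeZero (blockSize θ i) := ⟨(blockSize_pos θ i).ne'⟩

/-- The digit sequence chosen by `ω`. -/
noncomputable def blockDigits (θ : ℝ) (ω : ∀ i, Fin (blockSize θ i)) (i : ℕ) : ℕ+ :=
  ⟨blockSize θ i + ω i, Nat.add_pos_left (blockSize_pos θ i) _⟩

section

variable {θ : ℝ}

theorem floor_mul_succ_le (hθ0 : 0 < θ) (hθ1 : θ ≤ 1) (n : ℕ) :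
    ⌊θ * (n + 1 : ℕ)⌋₊ ≤ ⌊θ * n⌋₊ + 1 := by
  rw [← Nat.floor_add_one (by positivity)]
  refine Nat.floor_le_floor ?_
  push_cast
  linarith

theorem floor_mul_le_succ (hθ0 : 0 < θ) (n : ℕ) : ⌊θ * n⌋₊ ≤ ⌊θ * (n + 1 : ℕ)⌋₊ := by
  refine Nat.floor_le_floor ?_
  push_cast
  linarith

theorem card_jumps (hθ0 : 0 < θ) (hθ1 : θ ≤ 1) (n : ℕ) :
    ((Finset.range n).filter fun i : ℕ => ⌊θ * i⌋₊ < ⌊θ * (i + 1 : ℕ)⌋₊).card = ⌊θ * n⌋₊ := by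
  induction n with
  | zero => simp
  | succ n ih =>
    rw [Finset.range_add_one, Finset.filter_insert]
    have h1 := floor_mul_succ_le hθ0 hθ1 n
    have h2 := floor_mul_le_succ hθ0 n
    split_ifs with h
    · rw [Finset.card_insert_of_notMem (by simp), ih]
      omega
    · rw [ih]
      omega

theorem tendsto_floor_mul (hθ0 : 0 < θ) : Tendsto (fun n : ℕ => ⌊θ * n⌋₊) atTop atTop :=
  tendsto_nat_floor_atTop.comp
    (tendsto_natCast_atTop_atTop.const_mul_atTop hθ0)

theorem exists_jump_ge (hθ0 : 0 < θ) (n : ℕ) :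
    ∃ i, n ≤ i ∧ ⌊θ * i⌋₊ < ⌊θ * (i + 1 : ℕ)⌋₊ := by
  by_contra! h
  have hle (m : ℕ) (hm : n ≤ m) : ⌊θ * m⌋₊ ≤ ⌊θ * n⌋₊ := by
    induction m, hm using Nat.le_induction with
    | base => exact le_rfl
    | succ m hm ih => exact (h m hm).trans ih
  obtain ⟨m, hm1, hm2⟩ := (((tendsto_floor_mul hθ0).eventually_gt_atTop ⌊θ * n⌋₊).and
    (eventually_ge_atTop n)).exists
  exact absurd (hle m hm2) (by omega)

theorem blockDigits_eq_one (ω : ∀ i, Fin (blockSize θ i)) {i : ℕ}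
    (hi : ¬ ⌊θ * i⌋₊ < ⌊θ * (i + 1 : ℕ)⌋₊) : blockDigits θ ω i = 1 := by
  have h1 : blockSize θ i = 1 := if_neg hi
  have h2 := (ω i).2
  refine PNat.eq ?_
  simp only [blockDigits, PNat.mk_coe, PNat.one_coe]
  omega

theorem blockDigits_lt_of_jump (ω : ∀ i, Fin (blockSize θ i)) {i j : ℕ} (hij : i < j)
    (hi : ⌊θ * i⌋₊ < ⌊θ * (i + 1 : ℕ)⌋₊) (hj : ⌊θ * j⌋₊ < ⌊θ * (j + 1 : ℕ)⌋₊) :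
    blockDigits θ ω i < blockDigits θ ω j := by
  have h1 : blockSize θ i = 2 ^ (i + 1) := if_pos hi
  have h2 : blockSize θ j = 2 ^ (j + 1) := if_pos hj
  have h3 := (ω i).2
  have h4 : 2 ^ (i + 2) ≤ 2 ^ (j + 1) := Nat.pow_le_pow_right (by norm_num) (by omega)
  rw [← PNat.coe_lt_coe]
  simp only [blockDigits, PNat.mk_coe]
  have h5 : 2 ^ (i + 2) = 2 * 2 ^ (i + 1) := by ring
  omega

theorem blockDigits_not_eventually_const (hθ0 : 0 < θ) (ω : ∀ i, Fin (blockSize θ i)) (n : ℕ) :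
    ∃ i, n ≤ i ∧ ∃ j, n ≤ j ∧ blockDigits θ ω i ≠ blockDigits θ ω j := by
  obtain ⟨i, hi, hi'⟩ := exists_jump_ge hθ0 n
  obtain ⟨j, hj, hj'⟩ := exists_jump_ge hθ0 (i + 1)
  exact ⟨i, hi, j, by omega, (blockDigits_lt_of_jump ω (by omega) hi' hj').ne⟩

theorem card_blockDigits_bounds (hθ0 : 0 < θ) (hθ1 : θ ≤ 1) (ω : ∀ i, Fin (blockSize θ i))
    (n : ℕ) : ⌊θ * n⌋₊ ≤ ((Finset.range n).image (blockDigits θ ω)).card ∧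
      ((Finset.range n).image (blockDigits θ ω)).card ≤ ⌊θ * n⌋₊ + 1 := by
  set J := (Finset.range n).filter fun i : ℕ => ⌊θ * i⌋₊ < ⌊θ * (i + 1 : ℕ)⌋₊ with hJ
  rw [← card_jumps hθ0 hθ1 n, ← hJ]
  constructor
  · have hinj : InjOn (blockDigits θ ω) J := by
      intro i hi j hj hij
      have hi' := (Finset.mem_filter.1 hi).2
      have hj' := (Finset.mem_filter.1 hj).2
      rcases lt_trichotomy i j with h | h | h
      · exact absurd hij (blockDigits_lt_of_jump ω h hi' hj').ne
      · exact h
      · exact absurd hij (blockDigits_lt_of_jump ω h hj' hi').ne'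
    rw [← Finset.card_image_of_injOn hinj]
    exact Finset.card_le_card (Finset.image_subset_image (Finset.filter_subset _ _))
  · refine (Finset.card_le_card (t := insert 1 (J.image (blockDigits θ ω))) fun k hk => ?_).trans
      ((Finset.card_insert_le _ _).trans (Nat.add_le_add_right Finset.card_image_le 1))
    obtain ⟨i, hi, rfl⟩ := Finset.mem_image.1 hk
    by_cases h : ⌊θ * i⌋₊ < ⌊θ * (i + 1 : ℕ)⌋₊
    · exact Finset.mem_insert_of_mem (Finset.mem_image_of_mem _ (Finset.mem_filter.2 ⟨hi, h⟩))
    · rw [blockDigits_eq_one ω h]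
      exact Finset.mem_insert_self _ _

end

namespace AffineSystem

variable (S : AffineSystem) {θ : ℝ}

theorem pointOfDigits_mem_levelSet (hθ0 : 0 < θ) (hθ1 : θ ≤ 1) (ω : ∀ i, Fin (blockSize θ i)) :
    S.pointOfDigits (blockDigits θ ω) ∈ S.levelSet θ := by
  have hmem := S.pointOfDigits_mem_cylinder (blockDigits_not_eventually_const hθ0 ω)
  refine ⟨by simpa [cylLeft, cylLength] using hmem 0, ?_⟩
  have hcount (n : ℕ) : S.distinctCount n (S.pointOfDigits (blockDigits θ ω)) =
      ((Finset.range n).image (blockDigits θ ω)).card := by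
    rw [distinctCount_eq]
    congr 1
    exact Finset.image_congr fun i hi =>
      S.digit_eq_of_mem_cylinder (hmem n) i (Finset.mem_range.1 hi)
  simp_rw [hcount]
  have hfloor := (tendsto_nat_floor_mul_div_atTop hθ0.le).comp
    (tendsto_natCast_atTop_atTop (R := ℝ))
  have hinv := hfloor.add (tendsto_one_div_atTop_nhds_zero_nat (𝕜 := ℝ))
  rw [add_zero] at hinv
  refine tendsto_of_tendsto_of_tendsto_of_le_of_le hfloor hinv (fun n => ?_) (fun n => ?_)
  · simp only [Function.comp_apply]
    gcongr
    exact (card_blockDigits_bounds hθ0 hθ1 ω n).1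
  · simp only [Function.comp_apply]
    rw [← add_div]
    gcongr
    exact_mod_cast (card_blockDigits_bounds hθ0 hθ1 ω n).2

end AffineSystem

/-! ### The uniform measure on block digit sequences -/

open MeasureTheory in
/-- The law of a sequence of independent choices, uniform in each block. -/
noncomputable def blockMeasure (θ : ℝ) : Measure (∀ i, Fin (blockSize θ i)) :=
  Measure.infinitePi fun _ => ProbabilityTheory.uniformOn univ

instance blockMeasure_isProbabilityMeasure (θ : ℝ) :
    MeasureTheory.IsProbabilityMeasure (blockMeasure θ) := by
  unfold blockMeasure
  infer_instance

/-- The entropy of the first `n` choices. -/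
noncomputable def blockEntropy (θ : ℝ) (n : ℕ) : ℝ :=
  ∑ i ∈ Finset.range n, Real.log (blockSize θ i)

theorem blockMeasure_agree (θ : ℝ) (ω : ∀ i, Fin (blockSize θ i)) (n : ℕ) :
    blockMeasure θ {η | ∀ i < n, η i = ω i} = ENNReal.ofReal (Real.exp (-blockEntropy θ n)) := by
  have h : {η : ∀ i, Fin (blockSize θ i) | ∀ i < n, η i = ω i} =
      Set.pi (Finset.range n) fun i => {ω i} := by
    ext η; simp
  rw [h, blockMeasure, MeasureTheory.Measure.infinitePi_pi _ fun i _ => measurableSet_singleton _,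
    blockEntropy, ← Finset.sum_neg_distrib, Real.exp_sum,
    ENNReal.ofReal_prod_of_nonneg fun i _ => (Real.exp_pos _).le]
  refine Finset.prod_congr rfl fun i _ => ?_
  have hpos : (0 : ℝ) < blockSize θ i := by exact_mod_cast blockSize_pos θ i
  rw [ProbabilityTheory.uniformOn_univ, MeasureTheory.Measure.count_singleton, Fintype.card_fin,
    Real.exp_neg, Real.exp_log hpos, ENNReal.ofReal_inv_of_pos hpos, ENNReal.ofReal_natCast,
    one_div]

theorem blockEntropy_succ_le (θ : ℝ) (n : ℕ) :
    blockEntropy θ (n + 1) ≤ blockEntropy θ n + (n + 1) * Real.log 2 := by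
  rw [blockEntropy, Finset.sum_range_succ, ← blockEntropy]
  gcongr
  unfold blockSize
  have := Real.log_nonneg (show (1 : ℝ) ≤ 2 by norm_num)
  split_ifs
  · simp
  · simp only [Nat.cast_one, Real.log_one]
    positivity

theorem le_blockEntropy {θ : ℝ} (hθ0 : 0 < θ) (hθ1 : θ ≤ 1) (n : ℕ) :
    (⌊θ * n⌋₊ : ℝ) ^ 2 / 2 * Real.log 2 ≤ blockEntropy θ n := by
  have hlog := Real.log_pos (show (1 : ℝ) < 2 by norm_num)
  induction n with
  | zero => simp [blockEntropy]
  | succ n ih =>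
    rw [blockEntropy, Finset.sum_range_succ, ← blockEntropy, blockSize]
    have h1 := floor_mul_succ_le hθ0 hθ1 n
    have h2 := floor_mul_le_succ hθ0 n
    have h3 : (⌊θ * n⌋₊ : ℝ) ≤ n := by
      exact_mod_cast Nat.floor_le_of_le (by nlinarith [(Nat.cast_nonneg n : (0 : ℝ) ≤ n)])
    split_ifs with h
    · have h4 : ⌊θ * (n + 1 : ℕ)⌋₊ = ⌊θ * n⌋₊ + 1 := by omega
      rw [h4]
      push_cast
      rw [Real.log_pow]
      push_cast
      nlinarith
    · have h4 : ⌊θ * (n + 1 : ℕ)⌋₊ = ⌊θ * n⌋₊ := by omega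
      rw [h4]
      simpa using ih

/-- The entropy grows superlinearly (in fact quadratically). -/
theorem eventually_mul_le_blockEntropy {θ : ℝ} (hθ0 : 0 < θ) (hθ1 : θ ≤ 1) (K : ℝ) :
    ∀ᶠ n : ℕ in atTop, K * (n + 1) ≤ blockEntropy θ n := by
  have hlog := Real.log_pos (show (1 : ℝ) < 2 by norm_num)
  filter_upwards [(tendsto_natCast_atTop_atTop (R := ℝ)).eventually_ge_atTop (2 / θ + 1),
    (tendsto_natCast_atTop_atTop (R := ℝ)).eventually_ge_atTop (8 * K / (θ ^ 2 * Real.log 2))]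
    with n h1 h2
  refine le_trans ?_ (le_blockEntropy hθ0 hθ1 n)
  have h3 : θ * n - 1 < ⌊θ * n⌋₊ := by linarith [Nat.lt_floor_add_one (θ * (n : ℝ))]
  have h4 : 2 ≤ θ * (n - 1) := by
    have : 2 / θ ≤ n - 1 := by linarith
    rwa [div_le_iff₀' hθ0] at this
  rw [div_le_iff₀ (by positivity)] at h2
  have h5 : θ * (n + 1) / 2 ≤ ⌊θ * n⌋₊ := by linarith
  have h6 : (θ * (n + 1) / 2) ^ 2 ≤ (⌊θ * n⌋₊ : ℝ) ^ 2 := by gcongr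
  have h7 : K ≤ (n + 1) * (θ ^ 2 * Real.log 2) / 8 := by
    have : 0 < θ ^ 2 * Real.log 2 := by positivity
    linarith
  calc K * (n + 1) ≤ (n + 1) * (θ ^ 2 * Real.log 2) / 8 * (n + 1) := by gcongr
    _ = (θ * (n + 1) / 2) ^ 2 / 2 * Real.log 2 := by ring
    _ ≤ _ := by gcongr

/-! ### The lower bound -/

namespace AffineSystem

variable (S : AffineSystem) {θ : ℝ}

theorem blockMeasure_mem_cylinder_le (n : ℕ) (z : ℝ) :
    blockMeasure θ {ω | z ∈ Ico (S.cylLeft (blockDigits θ ω) n)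
      (S.cylLeft (blockDigits θ ω) n + S.cylLength (blockDigits θ ω) n)} ≤
      ENNReal.ofReal (Real.exp (-blockEntropy θ n)) := by
  rcases eq_empty_or_nonempty {ω | z ∈ Ico (S.cylLeft (blockDigits θ ω) n)
      (S.cylLeft (blockDigits θ ω) n + S.cylLength (blockDigits θ ω) n)} with h | ⟨ω₀, h₀⟩
  · rw [h]; simp
  · rw [← blockMeasure_agree θ ω₀ n]
    refine MeasureTheory.measure_mono fun ω hω i hi => ?_
    have h1 := (S.digit_eq_of_mem_cylinder hω i hi).symm.trans
      (S.digit_eq_of_mem_cylinder h₀ i hi)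
    have h2 := congrArg PNat.val h1
    simp only [blockDigits, PNat.mk_coe] at h2
    exact Fin.ext (Nat.add_left_cancel h2)

theorem measurable_pointOfDigits_blockDigits :
    Measurable fun ω => S.pointOfDigits (blockDigits θ ω) := by
  have hcoord (f : ℕ+ → ℝ) (i : ℕ) :
      Measurable fun ω : ∀ i, Fin (blockSize θ i) => f (blockDigits θ ω i) :=
    (measurable_of_countable fun j : Fin (blockSize θ i) =>
      f ⟨blockSize θ i + j, Nat.add_pos_left (blockSize_pos θ i) _⟩).comp (measurable_pi_apply i)
  unfold pointOfDigits
  refine Measurable.iSup fun n => ?_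
  unfold cylLeft cylLength
  exact Finset.measurable_fun_sum _ fun i _ => (hcoord S.a i).mul
    (Finset.measurable_fun_prod _ fun j _ => hcoord S.p j)

/-- A set shorter than all cylinders of level `n` of the construction meets only those that contain
one of the two ends of its convex hull, so it carries at most twice the mass of a cylinder. -/
theorem map_blockMeasure_le (hθ0 : 0 < θ) {n : ℕ} {ℓ : ℝ}
    (hℓ : ∀ ω, ℓ ≤ S.cylLength (blockDigits θ ω) n) {A : Set ℝ}
    (hA : Metric.ediam A < ENNReal.ofReal ℓ) :
    (blockMeasure θ).map (fun ω => S.pointOfDigits (blockDigits θ ω)) A ≤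
      ENNReal.ofReal (2 * Real.exp (-blockEntropy θ n)) := by
  have hbdd : Bornology.IsBounded A := Metric.isBounded_iff_ediam_ne_top.2 hA.ne_top
  rw [Real.ediam_eq hbdd] at hA
  have hlt : sSup A - sInf A < ℓ := (ENNReal.ofReal_lt_ofReal_iff'.1 hA).1
  have hsub := subset_Icc_csInf_csSup hbdd.bddBelow hbdd.bddAbove
  set u := sInf A
  set v := sSup A
  refine (MeasureTheory.measure_mono hsub).trans ?_
  rw [MeasureTheory.Measure.map_apply S.measurable_pointOfDigits_blockDigits measurableSet_Icc]
  refine (MeasureTheory.measure_mono (t := {ω | u ∈ Ico (S.cylLeft (blockDigits θ ω) n)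
      (S.cylLeft (blockDigits θ ω) n + S.cylLength (blockDigits θ ω) n)} ∪
    {ω | v ∈ Ico (S.cylLeft (blockDigits θ ω) n)
      (S.cylLeft (blockDigits θ ω) n + S.cylLength (blockDigits θ ω) n)})
    fun ω hω => ?_).trans ((MeasureTheory.measure_union_le _ _).trans ?_)
  · obtain ⟨h1, h2⟩ := S.pointOfDigits_mem_cylinder (blockDigits_not_eventually_const hθ0 ω) n
    obtain ⟨h3, h4⟩ := hω
    have h5 := hℓ ω
    by_contra h
    simp only [mem_union, mem_ofPred_eq, mem_Ico, not_or, not_and_or, not_le, not_lt] at h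
    rcases h with ⟨h6 | h6, h7 | h7⟩ <;> linarith
  · rw [two_mul, ENNReal.ofReal_add (Real.exp_pos _).le (Real.exp_pos _).le]
    exact add_le_add (S.blockMeasure_mem_cylinder_le n u) (S.blockMeasure_mem_cylinder_le n v)

theorem exp_le_cylLength_blockDigits {c σ : ℝ} (hc : 0 < c) (hσ : 0 < σ)
    (hp : ∀ k : ℕ+, c * ((k : ℕ) : ℝ) ^ (-σ) ≤ S.p k) (ω : ∀ i, Fin (blockSize θ i)) (n : ℕ) :
    Real.exp (n * (Real.log c - σ * Real.log 2) - σ * blockEntropy θ n) ≤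
      S.cylLength (blockDigits θ ω) n := by
  have hexp : n * (Real.log c - σ * Real.log 2) - σ * blockEntropy θ n =
      ∑ i ∈ Finset.range n, (Real.log c - σ * Real.log (2 * blockSize θ i)) := by
    have (i : ℕ) : Real.log (2 * blockSize θ i) = Real.log 2 + Real.log (blockSize θ i) :=
      Real.log_mul (by norm_num) (by exact_mod_cast (blockSize_pos θ i).ne')
    simp_rw [this, blockEntropy, Finset.sum_sub_distrib, ← Finset.mul_sum, Finset.sum_add_distrib]
    simp
    ring
  rw [hexp, Real.exp_sum]
  refine Finset.prod_le_prod (fun i _ => (Real.exp_pos _).le) fun i _ => ?_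
  refine le_trans ?_ (hp _)
  have hpos : (0 : ℝ) < blockSize θ i := by exact_mod_cast blockSize_pos θ i
  have hle : (((blockDigits θ ω i : ℕ+) : ℕ) : ℝ) ≤ 2 * blockSize θ i := by
    have := (ω i).2
    simp only [blockDigits, PNat.mk_coe]
    exact_mod_cast (by omega : blockSize θ i + (ω i : ℕ) ≤ 2 * blockSize θ i)
  have hk : (0 : ℝ) < ((blockDigits θ ω i : ℕ+) : ℕ) := by
    exact_mod_cast (blockDigits θ ω i).pos
  rw [Real.exp_sub, Real.exp_log hc, div_eq_mul_inv, ← Real.exp_neg,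
    show -(σ * Real.log (2 * blockSize θ i)) = Real.log (2 * blockSize θ i) * -σ by ring,
    ← Real.rpow_def_of_pos (by positivity)]
  exact mul_le_mul_of_nonneg_left (Real.rpow_le_rpow_of_nonpos hk hle (by linarith)) hc.le

/-- The mass distribution principle for the block measure. The cylinder masses
`exp (-blockEntropy θ n)` decay superexponentially and with consecutive ratio `exp (O n)`, so the
scales strictly between two levels do not affect the exponent. -/
theorem hausdorffMeasure_levelSet_ne_zero (hθ0 : 0 < θ) (hθ1 : θ ≤ 1) {c σ s : ℝ} (hc : 0 < c)
    (hσ : 0 < σ) (hp : ∀ k : ℕ+, c * ((k : ℕ) : ℝ) ^ (-σ) ≤ S.p k) (hs : 0 < s)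
    (hsσ : s * σ < 1) : MeasureTheory.Measure.hausdorffMeasure s (S.levelSet θ) ≠ 0 := by
  set μ := (blockMeasure θ).map (fun ω => S.pointOfDigits (blockDigits θ ω)) with hμ
  set Γ := Real.log c - σ * Real.log 2 with hΓ
  have hlog := Real.log_pos (show (1 : ℝ) < 2 by norm_num)
  have hc1 : c < 1 := by
    have := hp 1
    simp only [PNat.one_coe, Nat.cast_one, Real.one_rpow, mul_one] at this
    exact this.trans_lt (S.p_lt_one 1)
  have hΓ0 : Γ < 0 := by
    have := Real.log_neg hc hc1
    have : 0 < σ * Real.log 2 := by positivity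
    linarith
  set ℓ : ℕ → ℝ := fun n => Real.exp (n * Γ - σ * blockEntropy θ n) with hℓ
  have hℓpos (n : ℕ) : 0 < ℓ n := Real.exp_pos _
  have hℓlim : Tendsto ℓ atTop (𝓝 0) := by
    refine Real.tendsto_exp_atBot.comp ?_
    have h1 : Tendsto (fun n : ℕ => (n : ℝ) * Γ) atTop atBot :=
      (tendsto_natCast_atTop_atTop (R := ℝ)).atTop_mul_const_of_neg hΓ0
    refine tendsto_atBot_mono (fun n => ?_) h1
    have h2 : 0 ≤ blockEntropy θ n :=
      (by positivity : (0 : ℝ) ≤ _).trans (le_blockEntropy hθ0 hθ1 n)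
    nlinarith
  have hmass (n : ℕ) {A : Set ℝ} (hA : Metric.ediam A < ENNReal.ofReal (ℓ n)) :
      μ A ≤ ENNReal.ofReal (2 * Real.exp (-blockEntropy θ n)) :=
    S.map_blockMeasure_le hθ0 (fun ω => S.exp_le_cylLength_blockDigits hc hσ hp ω n) hA
  obtain ⟨n₀, hn₀⟩ := eventually_atTop.1 (eventually_mul_le_blockEntropy hθ0 hθ1
    ((Real.log 2 + s * -Γ + s * σ * Real.log 2) / (1 - s * σ)))
  have hscale (n : ℕ) (hn : n₀ ≤ n) : 2 * Real.exp (-blockEntropy θ n) ≤ ℓ (n + 1) ^ s := by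
    have h1 := hn₀ n hn
    rw [div_mul_eq_mul_div, div_le_iff₀ (by linarith)] at h1
    have h2 := mul_le_mul_of_nonneg_left (blockEntropy_succ_le θ n) (mul_pos hs hσ).le
    rw [hℓ, ← Real.exp_mul]
    nth_rw 1 [← Real.exp_log (show (0 : ℝ) < 2 by norm_num)]
    rw [← Real.exp_add]
    refine Real.exp_le_exp.2 ?_
    push_cast
    have h3 : 0 ≤ (n : ℝ) * Real.log 2 := by positivity
    linarith
  have hle : μ ≤ MeasureTheory.Measure.hausdorffMeasure s := by
    refine MeasureTheory.Measure.le_hausdorffMeasure s μ (ENNReal.ofReal (ℓ n₀ / 2))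
      (ENNReal.ofReal_pos.2 (half_pos (hℓpos n₀))) fun A hA => ?_
    have htop : Metric.ediam A ≠ ⊤ := (hA.trans_lt ENNReal.ofReal_lt_top).ne
    obtain ⟨r, hr0, hr⟩ : ∃ r : ℝ, 0 ≤ r ∧ Metric.ediam A = ENNReal.ofReal r :=
      ⟨_, ENNReal.toReal_nonneg, (ENNReal.ofReal_toReal htop).symm⟩
    rw [hr] at hA ⊢
    have hrn₀ : r < ℓ n₀ := by
      have := (ENNReal.ofReal_le_ofReal_iff (half_pos (hℓpos n₀)).le).1 hA
      linarith [hℓpos n₀]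
    have hmass' (n : ℕ) (hn : n₀ ≤ n) (hrn : r < ℓ n) : μ A ≤ ENNReal.ofReal (ℓ (n + 1) ^ s) := by
      refine (hmass n ?_).trans (ENNReal.ofReal_le_ofReal (hscale n hn))
      rw [hr]
      exact (ENNReal.ofReal_lt_ofReal_iff (hℓpos n)).2 hrn
    rw [ENNReal.ofReal_rpow_of_nonneg hr0 hs.le]
    rcases hr0.eq_or_lt with rfl | hrpos
    · have hlim : Tendsto (fun n => ENNReal.ofReal (ℓ (n + 1) ^ s)) atTop
          (𝓝 (ENNReal.ofReal (0 ^ s))) :=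
        ENNReal.tendsto_ofReal
          (((tendsto_add_atTop_iff_nat 1).2 hℓlim).rpow_const (Or.inr hs.le))
      refine ge_of_tendsto hlim ?_
      filter_upwards [eventually_ge_atTop n₀] with n hn
      exact hmass' n hn (hℓpos n)
    -- The first level `n ≥ n₀` with `ℓ n ≤ r` is a successor `m + 1`, and `r < ℓ m`.
    · have hex : ∃ n, n₀ ≤ n ∧ ℓ n ≤ r :=
        ((eventually_ge_atTop n₀).and (hℓlim.eventually_le_const hrpos)).exists
      classical
      obtain ⟨hn, hnr⟩ := Nat.find_spec hex
      have hmin := fun m => Nat.find_min hex (m := m)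
      set n := Nat.find hex
      have hne : n ≠ n₀ := fun h => by rw [h] at hnr; linarith
      obtain ⟨m, hm⟩ : ∃ m, n = m + 1 := Nat.exists_eq_succ_of_ne_zero (by omega)
      have hmn := hmin m (by omega)
      rw [hm] at hnr
      refine (hmass' m (by omega) ?_).trans
        (ENNReal.ofReal_le_ofReal (Real.rpow_le_rpow (hℓpos _).le hnr hs.le))
      by_contra! h
      exact hmn ⟨by omega, h⟩
  intro h0
  have h1 : μ (S.levelSet θ) ≤ 0 := h0 ▸ hle _
  have h2 := MeasureTheory.Measure.le_map_apply
    (S.measurable_pointOfDigits_blockDigits (θ := θ)).aemeasurable (μ := blockMeasure θ)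
    (S.levelSet θ)
  have h3 : (fun ω => S.pointOfDigits (blockDigits θ ω)) ⁻¹' S.levelSet θ = univ :=
    eq_univ_of_forall fun ω => S.pointOfDigits_mem_levelSet hθ0 hθ1 ω
  rw [h3, MeasureTheory.measure_univ] at h2
  exact absurd (h2.trans h1) (by simp)

theorem le_dimH_levelSet {ρ : ℝ} (hρ : 0 < ρ) (hp : RegularlyVarying S.p ρ) (hθ0 : 0 < θ)
    (hθ1 : θ ≤ 1) : ENNReal.ofReal (1 / ρ) ≤ dimH (S.levelSet θ) := by
  refine le_of_forall_lt_imp_le_of_dense fun s hs => ?_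
  lift s to NNReal using hs.ne_top
  rcases eq_zero_or_pos s with rfl | hs0
  · simp
  have hs0' : (0 : ℝ) < s := by exact_mod_cast hs0
  have hsρ : (s : ℝ) < 1 / ρ := by
    rw [← ENNReal.ofReal_coe_nnreal] at hs
    exact (ENNReal.ofReal_lt_ofReal_iff'.1 hs).1
  have hsρ' : ρ < 1 / s := by
    rw [lt_div_iff₀ hρ] at hsρ
    rw [lt_div_iff₀ hs0']
    linarith
  -- The midpoint of `ρ` and `1 / s` is an admissible exponent for the lower bound of `p`.
  obtain ⟨c, hc, h⟩ := hp.exists_rpow_le S.p_pos (δ := (1 / s - ρ) / 2) (by linarith)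
  refine le_dimH_of_hausdorffMeasure_ne_zero
    (S.hausdorffMeasure_levelSet_ne_zero hθ0 hθ1 hc (by linarith) h hs0' ?_)
  have h1 : ρ + (1 / s - ρ) / 2 < 1 / s := by linarith
  rw [lt_div_iff₀ hs0'] at h1
  linarith

end AffineSystem

theorem theorem1 (S : AffineSystem) (ρ : ℝ) (hρ : 1 ≤ ρ) (hp : RegularlyVarying S.p ρ)
    (θ : ℝ) (hθ0 : 0 < θ) (hθ1 : θ ≤ 1) :
    dimH (S.levelSet θ) = ENNReal.ofReal (1 / ρ) ∧
      dimH (S.limsupSet θ) ≤ ENNReal.ofReal (1 / ρ) := by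
  have hρ0 : 0 < ρ := one_pos.trans_le hρ
  have hupper := S.dimH_limsupSet_le hρ0 hp hθ0
  exact ⟨((dimH_mono (S.levelSet_subset_limsupSet θ)).trans hupper).antisymm
    (S.le_dimH_levelSet hρ0 hp hθ0 hθ1), hupper⟩
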